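/- For a complex tensor $R=(r_{i_1\dots i_d})_{1\le i_1,\dots,i_d\le n}$ of order $d$ and dimension $n$ put $$\operatorname{per}(R)=\sum_{\sigma_2,\dots,\sigma_d\in S_n}\ \prod_{i=1}^{n} r_{i\,\sigma_2(i)\dots\sigma_d(i)} .$$ An entry distribution with mean $\mu\in\mathbb C$ is a probability distribution $\mathcal D_\mu$ on $\mathbb C$ with $E[x]=\mu$, $E|x-\mu|^2=1$ and $E|x-\mu|^3<\infty$; $\mathscr T_{d,n,\mu}$ denotes the distribution of a tensor of order $d$ and dimension $n$ whose entries are i.i.d. with law $\mathcal D_\mu$. **Corollary.** For any constants $c\in(0,\tfrac18)$ and $0<\rho<\tfrac18-c$ there is a deterministic algorithm $\mathcal P$ that, given a complex tensor $R$ of order $d$ and dimension $n$, computes a complex number $\mathcal P(R)$ in time polynomial in the size of the input (the $n^d$ entries together with $n$ and $d$; the cost is counted in arithmetic operations on complex numbers and machine instructions), such that the following holds. Let $d=d(n)\ge 3$ with $d(n)=O((\ln n)^{k})$ for some $k$, let $\mu=\mu(n)\in\mathbb C$ satisfy, for all large $n$, $$|\mu|\ \ge\ \Bigl(\frac{\ln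 n}{(d-1)^{6}}\Bigr)^{-c},$$ and let $\mathcal D_{\mu}$ be entry distributions with mean $\mu=\mu(n)$ whose third absolute central moments are bounded by a constant independent of $n$. If $R$ is sampled from $\mathscr T_{d,n,\mu}$, then $$P\Bigl(\Bigl|1-\frac{\mathcal P(R)}{\operatorname{per}(R)}\Bigr|\le n^{-\rho}\Bigr)=1-o(1)\qquad(n\to\infty),$$ where the probability is taken over $R$. -/

import Mathlib

open MeasureTheory Filter Topology Asymptotics

noncomputable section

/-! ### Tensors, permanents, entry distributions -/

/-- Complex tensors of order `d` and dimension `n`: the entry `a_{i_1 … i_d}` is `A i`. -/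
abbrev Tensor (d n : ℕ) : Type := (Fin d → Fin n) → ℂ

/-- The permanent `∑ ∏_i a_{i, σ_2(i), …, σ_d(i)}`, summed over all permutations `σ_2, …, σ_d`
of the index set.  A tuple of permutations is indexed by all `d` coordinates, and the one
belonging to the first coordinate is required to be the identity. -/
def tensorPer {d n : ℕ} (A : Tensor d n) : ℂ :=
  ∑ σ : {σ : Fin d → Equiv.Perm (Fin n) // ∀ k : Fin d, k.val = 0 → σ k = 1},
    ∏ i : Fin n, A (fun k => σ.1 k i)

/-- `ν` is an entry distribution with mean `μ`: a probability distribution on `ℂ` with mean `μ`,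
variance `1` and a finite third absolute central moment. -/
structure IsEntryDistribution (ν : Measure ℂ) (μ : ℂ) : Prop where
  prob : IsProbabilityMeasure ν
  integrable : Integrable (fun x : ℂ => x) ν
  mean : ∫ x, x ∂ν = μ
  variance_integrable : Integrable (fun x : ℂ => ‖x - μ‖ ^ 2) ν
  variance : ∫ x, ‖x - μ‖ ^ 2 ∂ν = 1
  third_integrable : Integrable (fun x : ℂ => ‖x - μ‖ ^ 3) ν

/-- The law of a random tensor whose entries are i.i.d. with law `ν`. -/
def tensorDistribution (d n : ℕ) (ν : Measure ℂ) : Measure (Tensor d n) :=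
  Measure.pi fun _ : Fin d → Fin n => ν

/-! ### The machine model

A random access machine over the field `ℂ` with unit cost arithmetic.  It has registers for
natural numbers (counters and addresses), registers for complex numbers, and an addressable memory
of complex numbers.  A program is a finite expression; the only numerical constants in it are
natural numbers and Gaussian rationals, and the only operations on complex numbers are the four
field operations and the test for zero. -/

/-- The state of the machine. -/
structure RamState where
  nat : ℕ → ℕ
  reg : ℕ → ℂ
  mem : ℕ → ℂ

/-- The four field operations (with quotient `0` when the divisor is `0`, a case that programs can
also detect by a test). -/
inductive FieldOp
  | add
  | sub
  | mul
  | div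

def FieldOp.eval : FieldOp → ℂ → ℂ → ℂ
  | .add, x, y => x + y
  | .sub, x, y => x - y
  | .mul, x, y => x * y
  | .div, x, y => x / y

/-- The elementary instructions. -/
inductive RamInstr
  /-- natural register `x` receives the constant `k` -/
  | natConst (x k : ℕ)
  /-- natural register `x` receives the sum of the natural registers `y` and `z` -/
  | natAdd (x y z : ℕ)
  /-- natural register `x` receives the truncated difference of the natural registers
  `y` and `z` -/
  | natSub (x y z : ℕ)
  /-- complex register `r` receives the constant `a + b i` -/
  | const (r : ℕ) (a b : ℚ)
  /-- complex register `r` receives the result of the operation on the complex registers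
  `p` and `q` -/
  | arith (op : FieldOp) (r p q : ℕ)
  /-- complex register `r` receives the content of the memory cell whose address is in the natural
  register `x` -/
  | load (r x : ℕ)
  /-- the memory cell whose address is in the natural register `x` receives the content of the
  complex register `r` -/
  | store (x r : ℕ)

/-- The effect of an elementary instruction. -/
def RamInstr.apply : RamInstr → RamState → RamState
  | .natConst x k, s => { s with nat := Function.update s.nat x k }
  | .natAdd x y z, s => { s with nat := Function.update s.nat x (s.nat y + s.nat z) }
  | .natSub x y z, s => { s with nat := Function.update s.nat x (s.nat y - s.nat z) }
  | .const r a b, s =>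
      { s with reg := Function.update s.reg r ((a : ℂ) + (b : ℂ) * Complex.I) }
  | .arith op r p q, s =>
      { s with reg := Function.update s.reg r (op.eval (s.reg p) (s.reg q)) }
  | .load r x, s => { s with reg := Function.update s.reg r (s.mem (s.nat x)) }
  | .store x r, s => { s with mem := Function.update s.mem (s.nat x) (s.reg r) }

/-- Programs: elementary instructions, sequential composition, branching on a natural register or
on a complex register being zero, and loops that run while a natural register is not zero. -/
inductive RamProgram
  | instr (i : RamInstr)
  | seq (p q : RamProgram)
  | ifNatZero (x : ℕ) (p q : RamProgram)
  | ifRegZero (r : ℕ) (p q : RamProgram)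
  | whileNat (x : ℕ) (p : RamProgram)

/-- `RamExec p s t s'`: the program `p`, started in the state `s`, halts in the state `s'` after
exactly `t` steps.  Every elementary instruction and every test costs one step. -/
inductive RamExec : RamProgram → RamState → ℕ → RamState → Prop
  | instr (i : RamInstr) (s : RamState) : RamExec (.instr i) s 1 (i.apply s)
  | seq {p q : RamProgram} {s s₁ s₂ : RamState} {t₁ t₂ : ℕ} :
      RamExec p s t₁ s₁ → RamExec q s₁ t₂ s₂ → RamExec (.seq p q) s (t₁ + t₂) s₂
  | ifNatZero_true {x : ℕ} {p q : RamProgram} {s s' : RamState} {t : ℕ} :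
      s.nat x = 0 → RamExec p s t s' → RamExec (.ifNatZero x p q) s (t + 1) s'
  | ifNatZero_false {x : ℕ} {p q : RamProgram} {s s' : RamState} {t : ℕ} :
      s.nat x ≠ 0 → RamExec q s t s' → RamExec (.ifNatZero x p q) s (t + 1) s'
  | ifRegZero_true {r : ℕ} {p q : RamProgram} {s s' : RamState} {t : ℕ} :
      s.reg r = 0 → RamExec p s t s' → RamExec (.ifRegZero r p q) s (t + 1) s'
  | ifRegZero_false {r : ℕ} {p q : RamProgram} {s s' : RamState} {t : ℕ} :
      s.reg r ≠ 0 → RamExec q s t s' → RamExec (.ifRegZero r p q) s (t + 1) s'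
  | while_done {x : ℕ} {p : RamProgram} {s : RamState} :
      s.nat x = 0 → RamExec (.whileNat x p) s 1 s
  | while_step {x : ℕ} {p : RamProgram} {s s₁ s₂ : RamState} {t₁ t₂ : ℕ} :
      s.nat x ≠ 0 → RamExec p s t₁ s₁ → RamExec (.whileNat x p) s₁ t₂ s₂ →
      RamExec (.whileNat x p) s (t₁ + t₂ + 1) s₂

/-- The machine is deterministic: the final state and the number of steps are determined by the
program and the initial state. -/
theorem RamExec.deterministic {p : RamProgram} {s s₁ s₂ : RamState} {t₁ t₂ : ℕ}
    (h₁ : RamExec p s t₁ s₁) (h₂ : RamExec p s t₂ s₂) : t₁ = t₂ ∧ s₁ = s₂ := by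
  induction h₁ generalizing t₂ s₂ with
  | instr i s => cases h₂; exact ⟨rfl, rfl⟩
  | seq _ _ ih₁ ih₂ =>
    cases h₂ with
    | seq k₁ k₂ =>
      obtain ⟨rfl, rfl⟩ := ih₁ k₁
      obtain ⟨rfl, rfl⟩ := ih₂ k₂
      exact ⟨rfl, rfl⟩
  | ifNatZero_true h _ ih =>
    cases h₂ with
    | ifNatZero_true _ k => obtain ⟨rfl, rfl⟩ := ih k; exact ⟨rfl, rfl⟩
    | ifNatZero_false h' _ => exact absurd h h'
  | ifNatZero_false h _ ih =>
    cases h₂ with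
    | ifNatZero_true h' _ => exact absurd h' h
    | ifNatZero_false _ k => obtain ⟨rfl, rfl⟩ := ih k; exact ⟨rfl, rfl⟩
  | ifRegZero_true h _ ih =>
    cases h₂ with
    | ifRegZero_true _ k => obtain ⟨rfl, rfl⟩ := ih k; exact ⟨rfl, rfl⟩
    | ifRegZero_false h' _ => exact absurd h h'
  | ifRegZero_false h _ ih =>
    cases h₂ with
    | ifRegZero_true h' _ => exact absurd h' h
    | ifRegZero_false _ k => obtain ⟨rfl, rfl⟩ := ih k; exact ⟨rfl, rfl⟩
  | while_done h =>
    cases h₂ with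
    | while_done _ => exact ⟨rfl, rfl⟩
    | while_step h' _ _ => exact absurd h h'
  | while_step h _ _ ih₁ ih₂ =>
    cases h₂ with
    | while_done h' => exact absurd h' h
    | while_step _ k₁ k₂ =>
      obtain ⟨rfl, rfl⟩ := ih₁ k₁
      obtain ⟨rfl, rfl⟩ := ih₂ k₂
      exact ⟨rfl, rfl⟩

/-- The initial state on input `R`: the natural registers `0` and `1` hold the dimension `n` and the
order `d`, the memory cells `0, …, n ^ d - 1` hold the entries of `R` (the entry with indices
`i_1, …, i_d`, counted from `0`, is in cell `∑ i_k n ^ (k - 1)`), and everything else is `0`. -/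
def ramInput {d n : ℕ} (R : Tensor d n) : RamState where
  nat := fun x => if x = 0 then n else if x = 1 then d else 0
  reg := fun _ => 0
  mem := fun a => if h : a < n ^ d then R (finFunctionFinEquiv.symm ⟨a, h⟩) else 0

/-- The function `F` on tensors is computed in polynomial time by a deterministic algorithm: a
single program computes `F R`, left in the complex register `0`, for the tensors `R` of all orders
and dimensions, and the number of steps is bounded by a polynomial in the size of the input, which
is the number `n ^ d` of entries together with `n` and `d`. -/
def IsPolyTimeComputable (F : ∀ d n : ℕ, Tensor d n → ℂ) : Prop :=
  ∃ (p : RamProgram) (K : ℕ), ∀ (d n : ℕ) (R : Tensor d n),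
    ∃ (t : ℕ) (s : RamState), RamExec p (ramInput R) t s ∧ s.reg 0 = F d n R ∧
      t ≤ K * (n ^ d + n + d) ^ K

end

/-! The algorithm replaces every entry of `R` by the mean entry, so it returns `(n!) ^ (d - 1)`
times the `n`-th power of that mean (`meanPermanent`). A program for this runs in quadratically many
steps in the input size.

Accuracy is a second moment argument. Put `v = |μ|⁻²`, let `X` be `per R` divided by its expectation
`(n!) ^ (d - 1) * μ ^ n`, and let `U` be the mean entry divided by `μ`; the output divided by `per
R` is `U ^ n / X`. Both `X` and `U` are averages of products of normalized entries over sets of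
cells, and `E|X - 1|²` is the average of `(1 + v) ^ m - 1` over pairs of permutation tuples, `m`
being the number of common cells. For `d ≥ 3` two tuples rarely share a cell, and the average is at
most `exp v / n` (`sum_one_add_pow_card_agree_le`). Similarly `E|U - 1|² = v / n ^ d`, small enough
to survive the `n`-th power. By Chebyshev the relative error exceeds `ε` with probability at most
`80 exp v / (n ε²)`. The lower bound on `|μ|` gives `exp v ≤ n ^ (1/4)`, and `ε = n ^ (-ρ)` with `ρ
< 1/8` makes this at most `80 n ^ (-1/2)`. -/

/-! ### Verification of programs -/

/-- From every state satisfying `Pre`, the program halts within `T` steps in a state satisfying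
`Post`. -/
def RamProgram.Runs (p : RamProgram) (T : ℕ) (Pre Post : RamState → Prop) : Prop :=
  ∀ s, Pre s → ∃ t s', RamExec p s t s' ∧ t ≤ T ∧ Post s'

namespace RamProgram

theorem runs_instr (i : RamInstr) (Post : RamState → Prop) :
    (instr i).Runs 1 (fun s => Post (i.apply s)) Post :=
  fun s h => ⟨1, i.apply s, .instr i s, le_rfl, h⟩

theorem Runs.seq {p q : RamProgram} {T₁ T₂ : ℕ} {Pre Mid Post : RamState → Prop}
    (h₁ : p.Runs T₁ Pre Mid) (h₂ : q.Runs T₂ Mid Post) :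
    (RamProgram.seq p q).Runs (T₁ + T₂) Pre Post := by
  intro s hs
  obtain ⟨t₁, s₁, e₁, l₁, m⟩ := h₁ s hs
  obtain ⟨t₂, s₂, e₂, l₂, r⟩ := h₂ s₁ m
  exact ⟨_, _, .seq e₁ e₂, add_le_add l₁ l₂, r⟩

theorem Runs.mono {p : RamProgram} {T : ℕ} {Pre Pre' Post Post' : RamState → Prop}
    (h : p.Runs T Pre Post) (h₁ : ∀ s, Pre' s → Pre s) (h₂ : ∀ s, Post s → Post' s) :
    p.Runs T Pre' Post' := by
  intro s hs
  obtain ⟨t, s', e, l, r⟩ := h s (h₁ s hs)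
  exact ⟨t, s', e, l, h₂ _ r⟩

/-- A loop whose body takes the invariant `Inv (k + 1)` to `Inv k`, where `Inv k` entails that the
loop counter is `k`. -/
theorem runs_while {p : RamProgram} {x T : ℕ} {Inv : ℕ → RamState → Prop}
    (hx : ∀ k s, Inv k s → s.nat x = k) (hp : ∀ k, p.Runs T (Inv (k + 1)) (Inv k)) (m : ℕ) :
    (whileNat x p).Runs (m * (T + 1) + 1) (Inv m) (Inv 0) := by
  induction m with
  | zero => exact fun s hs => ⟨1, s, .while_done (hx 0 s hs), by simp, hs⟩
  | succ k ih =>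
    intro s hs
    obtain ⟨t₁, s₁, e₁, l₁, m₁⟩ := hp k s hs
    obtain ⟨t₂, s₂, e₂, l₂, m₂⟩ := ih s₁ m₁
    refine ⟨_, _, .while_step (by simp [hx _ s hs]) e₁ e₂, ?_, m₂⟩
    nlinarith

/-- Straight-line programs. -/
def block : List RamInstr → RamProgram
  | [] => instr (.natConst 2 1)
  | [i] => instr i
  | i :: j :: l => seq (instr i) (block (j :: l))

theorem runs_block {Pre Post : RamState → Prop} : ∀ (i : RamInstr) (l : List RamInstr),
    (∀ s, Pre s → Post ((i :: l).foldl (fun s i => i.apply s) s)) →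
    (block (i :: l)).Runs (l.length + 1) Pre Post
  | i, [], h => (runs_instr i Post).mono h fun _ => id
  | i, j :: l, h => by
    have h₁ := runs_instr i fun s => Post ((j :: l).foldl (fun s i => i.apply s) s)
    have h₂ := runs_block (Pre := fun s => Post ((j :: l).foldl (fun s i => i.apply s) s))
      (Post := Post) j l fun _ => id
    have := (h₁.seq h₂).mono h fun _ => id
    rwa [show 1 + (l.length + 1) = (j :: l).length + 1 by simp [add_comm]] at this

/-! ### The program and its loop invariants. -/

/-- Multiplies register `3` by register `0`, using the counter `5` and the accumulator `6`. -/
def natMulLoop : RamProgram := whileNat 5 (block [.natAdd 6 6 3, .natSub 5 5 2])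

/-- Leaves `n ^ d` in natural register `3`. -/
def natPowLoop : RamProgram :=
  whileNat 4 (seq (block [.natConst 6 0, .natAdd 5 0 7])
    (seq natMulLoop (block [.natAdd 3 6 7, .natSub 4 4 2])))

/-- Adds up the memory cells below the number in natural register `3`, and counts them. -/
def sumLoop : RamProgram :=
  whileNat 3 (block [.natSub 3 3 2, .load 4 3, .arith .add 1 1 4, .arith .add 2 2 3])

/-- Computes an `n`-th power and a factorial. -/
def powFactorialLoop : RamProgram :=
  whileNat 4 (block [.arith .mul 0 0 7, .arith .add 5 5 3, .arith .mul 6 6 5, .natSub 4 4 2])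

/-- Multiplies by a power of complex register `6`. -/
def scaleLoop : RamProgram := whileNat 4 (block [.arith .mul 0 0 6, .natSub 4 4 2])

/-- The program that computes `(n !) ^ (d - 1)` times the `n`-th power of the mean entry. -/
def meanPower : RamProgram :=
  -- Natural register `7` is never written, so it stays `0` and adding it copies a register. Natural
  -- register `2` and complex register `3` hold the constant `1`; complex registers `1`, `2`, `5`
  -- rely on their initial value `0`.
  seq (block [.natConst 2 1, .natConst 3 1, .natAdd 4 1 7, .const 3 1 0, .const 0 1 0,
    .const 6 1 0]) <|
  seq natPowLoop <|
  seq sumLoop <|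
  seq (block [.arith .div 7 1 2, .natAdd 4 0 7]) <|
  seq powFactorialLoop <|
  seq (block [.natSub 4 1 2]) scaleLoop

variable (n d : ℕ) (m : ℕ → ℂ)

/-- The registers and memory that no loop of `meanPower` changes. -/
structure Frame (s : RamState) : Prop where
  dim : s.nat 0 = n
  order : s.nat 1 = d
  one : s.nat 2 = 1
  zero : s.nat 7 = 0
  regOne : s.reg 3 = 1
  mem : s.mem = m

/-- The invariant, as in most of the loops below, says that the accumulator together with the
contribution of the `k` remaining rounds gives the final value. -/
theorem runs_natMulLoop (N D : ℕ) (r : ℕ → ℂ) :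
    natMulLoop.Runs (n * 3 + 1)
      (fun s => Frame n d m s ∧ s.reg = r ∧ s.nat 3 = N ∧ s.nat 4 = D ∧ s.nat 5 = n ∧ s.nat 6 = 0)
      (fun s => Frame n d m s ∧ s.reg = r ∧ s.nat 3 = N ∧ s.nat 4 = D ∧ s.nat 6 = n * N) := by
  refine (runs_while (T := 2) (Inv := fun k s => Frame n d m s ∧ s.reg = r ∧ s.nat 3 = N ∧
    s.nat 4 = D ∧ s.nat 5 = k ∧ s.nat 6 + k * N = n * N) (fun k s h => h.2.2.2.2.1) ?_ n).mono ?_ ?_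
  · intro k
    refine runs_block _ _ ?_
    rintro s ⟨⟨h0, h1, h2, h7, h3', hm⟩, hr, h3, h4, h5, h6⟩
    refine ⟨⟨?_, ?_, ?_, ?_, ?_, ?_⟩, ?_, ?_, ?_, ?_, ?_⟩ <;>
      simp_all [RamInstr.apply]
    rw [← h6]; ring
  · rintro s ⟨h, hr, h3, h4, h5, h6⟩
    exact ⟨h, hr, h3, h4, h5, by simp [h6]⟩
  · rintro s ⟨h, hr, h3, h4, h5, h6⟩
    exact ⟨h, hr, h3, h4, by simpa using h6⟩

theorem runs_natPowLoop (r : ℕ → ℂ) :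
    natPowLoop.Runs (d * (2 + ((n * 3 + 1) + 2) + 1) + 1)
      (fun s => Frame n d m s ∧ s.reg = r ∧ s.nat 3 = 1 ∧ s.nat 4 = d)
      (fun s => Frame n d m s ∧ s.reg = r ∧ s.nat 3 = n ^ d) := by
  refine (runs_while (Inv := fun k s => Frame n d m s ∧ s.reg = r ∧ s.nat 4 = k ∧
    s.nat 3 * n ^ k = n ^ d) (fun k s h => h.2.2.1) ?_ d).mono ?_ ?_
  · intro k s₀ hs₀
    -- The state `s₀` at the start of the round is fixed, so that `s₀.nat 3` can serve as the
    -- parameter `N` of the inner multiplication.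
    refine Runs.seq (Pre := fun s => Frame n d m s ∧ s.reg = r ∧ s.nat 4 = k + 1 ∧
      s.nat 3 = s₀.nat 3) ?_ (Runs.seq (runs_natMulLoop n d m (s₀.nat 3) (k + 1) r) ?_) s₀
        ⟨hs₀.1, hs₀.2.1, hs₀.2.2.1, rfl⟩
    · refine runs_block _ _ ?_
      rintro s ⟨⟨h0, h1, h2, h7, h3', hm⟩, hr, h4, h3⟩
      refine ⟨⟨?_, ?_, ?_, ?_, ?_, ?_⟩, ?_, ?_, ?_, ?_, ?_⟩ <;>
        simp_all [RamInstr.apply]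
    · refine runs_block _ _ ?_
      rintro s ⟨⟨h0, h1, h2, h7, h3', hm⟩, hr, h3, h4, h6⟩
      have := hs₀.2.2.2
      refine ⟨⟨?_, ?_, ?_, ?_, ?_, ?_⟩, ?_, ?_, ?_⟩ <;>
        simp_all [RamInstr.apply]
      rw [← this]; ring
  · rintro s ⟨h, hr, h3, h4⟩
    exact ⟨h, hr, h4, by simp [h3]⟩
  · rintro s ⟨h, hr, h4, h3⟩
    exact ⟨h, hr, by simpa using h3⟩

theorem runs_sumLoop (N : ℕ) :
    sumLoop.Runs (N * (4 + 1) + 1)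
      (fun s => Frame n d m s ∧ s.nat 3 = N ∧ s.reg 0 = 1 ∧ s.reg 1 = 0 ∧ s.reg 2 = 0 ∧
        s.reg 5 = 0 ∧ s.reg 6 = 1)
      (fun s => Frame n d m s ∧ s.reg 0 = 1 ∧ s.reg 1 = ∑ a ∈ Finset.range N, m a ∧ s.reg 2 = N ∧
        s.reg 5 = 0 ∧ s.reg 6 = 1) := by
  refine (runs_while (Inv := fun k s => Frame n d m s ∧ s.nat 3 = k ∧ s.reg 0 = 1 ∧
    s.reg 1 + ∑ a ∈ Finset.range k, m a = ∑ a ∈ Finset.range N, m a ∧ s.reg 2 + k = N ∧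
    s.reg 5 = 0 ∧ s.reg 6 = 1) (fun k s h => h.2.1) ?_ N).mono ?_ ?_
  · intro k
    refine runs_block _ _ ?_
    rintro s ⟨⟨h0, h1, h2, h7, h3', hm⟩, h3, r0, r1, r2, r5, r6⟩
    refine ⟨⟨?_, ?_, ?_, ?_, ?_, ?_⟩, ?_, ?_, ?_, ?_, ?_, ?_⟩ <;>
      simp_all [RamInstr.apply, FieldOp.eval]
    · rw [← r1, Finset.sum_range_succ]; ring
    · rw [← r2]; ring
  · rintro s ⟨h, h3, r0, r1, r2, r5, r6⟩
    exact ⟨h, h3, r0, by simp [r1], by simp [r2], r5, r6⟩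
  · rintro s ⟨h, h3, r0, r1, r2, r5, r6⟩
    exact ⟨h, r0, by simpa using r1, by simpa using r2, r5, r6⟩

theorem runs_powFactorialLoop (y : ℂ) :
    powFactorialLoop.Runs (n * (4 + 1) + 1)
      (fun s => Frame n d m s ∧ s.nat 4 = n ∧ s.reg 0 = 1 ∧ s.reg 5 = 0 ∧ s.reg 6 = 1 ∧
        s.reg 7 = y)
      (fun s => Frame n d m s ∧ s.reg 0 = y ^ n ∧ s.reg 6 = n.factorial) := by
  -- The factorial is built upwards, so the invariant tracks the number `j` of completed rounds,
  -- which complex register `5` also holds.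
  refine (runs_while (Inv := fun k s => Frame n d m s ∧ s.nat 4 = k ∧ s.reg 7 = y ∧
    ∃ j, j + k = n ∧ s.reg 0 = y ^ j ∧ s.reg 5 = j ∧ s.reg 6 = j.factorial)
    (fun k s h => h.2.1) ?_ n).mono ?_ ?_
  · intro k
    refine runs_block _ _ ?_
    rintro s ⟨⟨h0, h1, h2, h7, h3', hm⟩, h4, r7, j, rfl, r0, r5, r6⟩
    refine ⟨⟨?_, ?_, ?_, ?_, ?_, ?_⟩, ?_, ?_, j + 1, ?_, ?_, ?_, ?_⟩ <;>
      first | omega | simp_all [RamInstr.apply, FieldOp.eval, pow_succ, Nat.factorial_succ, mul_comm]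
  · rintro s ⟨h, h4, r0, r5, r6, r7⟩
    exact ⟨h, h4, r7, 0, by simp, by simp [r0], by simp [r5], by simp [r6]⟩
  · rintro s ⟨h, h4, r7, j, rfl, r0, r5, r6⟩
    exact ⟨h, r0, r6⟩

theorem runs_scaleLoop (D : ℕ) (y f : ℂ) :
    scaleLoop.Runs (D * (2 + 1) + 1)
      (fun s => Frame n d m s ∧ s.nat 4 = D ∧ s.reg 0 = y ∧ s.reg 6 = f)
      (fun s => s.reg 0 = f ^ D * y) := by
  refine (runs_while (Inv := fun k s => Frame n d m s ∧ s.nat 4 = k ∧ s.reg 6 = f ∧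
    s.reg 0 * f ^ k = f ^ D * y) (fun k s h => h.2.1) ?_ D).mono ?_ ?_
  · intro k
    refine runs_block _ _ ?_
    rintro s ⟨⟨h0, h1, h2, h7, h3', hm⟩, h4, r6, r0⟩
    refine ⟨⟨?_, ?_, ?_, ?_, ?_, ?_⟩, ?_, ?_, ?_⟩ <;>
      simp_all [RamInstr.apply, FieldOp.eval]
    rw [← r0]; ring
  · rintro s ⟨h, h4, r0, r6⟩
    exact ⟨h, h4, r6, by rw [r0]; ring⟩
  · rintro s ⟨h, h4, r6, r0⟩
    simpa using r0

theorem runs_meanPower :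
    meanPower.Runs
      (6 + ((d * (2 + ((n * 3 + 1) + 2) + 1) + 1) + ((n ^ d * (4 + 1) + 1) + (2 +
        ((n * (4 + 1) + 1) + (1 + ((d - 1) * (2 + 1) + 1)))))))
      (fun s => s.nat 0 = n ∧ s.nat 1 = d ∧ s.nat 7 = 0 ∧ s.reg = 0 ∧ s.mem = m)
      (fun s => s.reg 0 = (n.factorial : ℂ) ^ (d - 1) *
        ((∑ a ∈ Finset.range (n ^ d), m a) / ((n ^ d : ℕ) : ℂ)) ^ n) := by
  refine Runs.seq ?_ <| Runs.seq (runs_natPowLoop n d m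
      (fun i => if i = 0 ∨ i = 3 ∨ i = 6 then 1 else 0)) <|
    Runs.seq ((runs_sumLoop n d m (n ^ d)).mono ?_ fun _ => id) <|
    Runs.seq ?_ <| Runs.seq (runs_powFactorialLoop n d m
      ((∑ a ∈ Finset.range (n ^ d), m a) / ((n ^ d : ℕ) : ℂ))) <|
    Runs.seq ?_ (runs_scaleLoop n d m (d - 1) _ _)
  · refine runs_block _ _ ?_
    rintro s ⟨h0, h1, h7, hr, hm⟩
    refine ⟨⟨?_, ?_, ?_, ?_, ?_, ?_⟩, ?_, ?_, ?_⟩ <;>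
      simp_all [RamInstr.apply]
    funext i
    simp only [Function.update_apply, Pi.zero_apply]
    split_ifs <;> simp_all
  · rintro s ⟨h, hr, h3⟩
    exact ⟨h, h3, by simp [hr], by simp [hr], by simp [hr], by simp [hr], by simp [hr]⟩
  · refine runs_block _ _ ?_
    rintro s ⟨⟨h0, h1, h2, h7, h3', hm⟩, r0, r1, r2, r5, r6⟩
    refine ⟨⟨?_, ?_, ?_, ?_, ?_, ?_⟩, ?_, ?_, ?_, ?_, ?_⟩ <;>
      simp_all [RamInstr.apply, FieldOp.eval]
  · refine runs_block _ _ ?_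
    rintro s ⟨⟨h0, h1, h2, h7, h3', hm⟩, r0, r6⟩
    refine ⟨⟨?_, ?_, ?_, ?_, ?_, ?_⟩, ?_, ?_, ?_⟩ <;>
      simp_all [RamInstr.apply]

end RamProgram

/-- The approximation of the permanent by `(n !) ^ (d - 1)` times the `n`-th power of the mean
entry. -/
noncomputable def meanPermanent (d n : ℕ) (R : Tensor d n) : ℂ :=
  (n.factorial : ℂ) ^ (d - 1) * ((∑ e, R e) / ((n ^ d : ℕ) : ℂ)) ^ n

theorem isPolyTimeComputable_meanPermanent : IsPolyTimeComputable meanPermanent := by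
  refine ⟨RamProgram.meanPower, 40, fun d n R => ?_⟩
  obtain ⟨t, s, he, ht, hs⟩ := RamProgram.runs_meanPower n d (ramInput R).mem (ramInput R)
    ⟨rfl, rfl, rfl, rfl, rfl⟩
  refine ⟨t, s, he, ?_, ht.trans ?_⟩
  · rw [hs, meanPermanent, ← Fin.sum_univ_eq_sum_range]
    congr 3
    rw [← finFunctionFinEquiv.symm.sum_comp]
    exact Finset.sum_congr rfl fun a _ => by simp [ramInput]
  -- The step count is at most `40 * z ^ 2`. The bound `1 ≤ z` holds even for `d = 0`, where `n ^ 0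
  -- = 1`; it allows the exponent to be raised to `40`.
  · set z := n ^ d + n + d with hz
    have h1 : 1 ≤ z := by
      rcases Nat.eq_zero_or_pos d with rfl | h
      · simp [hz]
      · omega
    have h2 : d * n ≤ z * z := Nat.mul_le_mul (by omega) (by omega)
    have h3 : z ≤ z * z := Nat.le_mul_self z
    have h4 : z * z ≤ z ^ 40 := by
      rw [← sq]; exact Nat.pow_le_pow_right h1 (by norm_num)
    have h5 : n ^ d ≤ z := by omega
    have h6 : d - 1 ≤ z := by omega
    have h7 : d * (2 + ((n * 3 + 1) + 2) + 1) = 3 * (d * n) + 6 * d := by ring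
    rw [h7]
    generalize n ^ d = w at *
    omega

/-! ### Second moments of averages of products of i.i.d. variables -/

open ComplexConjugate

section SecondMoment

variable {ν : Measure ℂ} {μ : ℂ}

theorem IsEntryDistribution.integral_div (h : IsEntryDistribution ν μ) (hμ : μ ≠ 0) :
    Integrable (fun x : ℂ => x / μ) ν ∧ ∫ x, x / μ ∂ν = 1 :=
  ⟨h.integrable.div_const μ, by rw [MeasureTheory.integral_div, h.mean, div_self hμ]⟩

theorem IsEntryDistribution.integral_conj_div (h : IsEntryDistribution ν μ) (hμ : μ ≠ 0) :
    Integrable (fun x : ℂ => conj (x / μ)) ν ∧ ∫ x, conj (x / μ) ∂ν = 1 := by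
  obtain ⟨h₁, h₂⟩ := h.integral_div hμ
  exact ⟨(Complex.conjCLE : ℂ →L[ℝ] ℂ).integrable_comp h₁, by rw [integral_conj, h₂, map_one]⟩

/-- With `y = x / μ`, this is `|y|² = |y - 1|² + y + (conj y - 1)` integrated term by term; the
first term contributes the variance divided by `|μ|²`. -/
theorem IsEntryDistribution.integral_div_mul_conj (h : IsEntryDistribution ν μ) (hμ : μ ≠ 0) :
    Integrable (fun x : ℂ => x / μ * conj (x / μ)) ν ∧
      ∫ x, x / μ * conj (x / μ) ∂ν = ((1 + (‖μ‖ ^ 2)⁻¹ : ℝ) : ℂ) := by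
  have := h.prob
  obtain ⟨i₁, m₁⟩ := h.integral_div hμ
  obtain ⟨i₂, m₂⟩ := h.integral_conj_div hμ
  have key : (fun x : ℂ => x / μ * conj (x / μ)) = fun x : ℂ =>
      ((‖x - μ‖ ^ 2 * (‖μ‖ ^ 2)⁻¹ : ℝ) : ℂ) + (x / μ + (conj (x / μ) - 1)) := by
    funext x
    have e : ((‖x - μ‖ ^ 2 * (‖μ‖ ^ 2)⁻¹ : ℝ) : ℂ) = (x / μ - 1) * conj (x / μ - 1) := by
      rw [Complex.mul_conj, Complex.normSq_eq_norm_sq, div_sub_one hμ, norm_div, div_pow,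
        div_eq_mul_inv]
    rw [e, map_sub, map_one]
    ring
  have i₃ : Integrable (fun x : ℂ => ((‖x - μ‖ ^ 2 * (‖μ‖ ^ 2)⁻¹ : ℝ) : ℂ)) ν :=
    (h.variance_integrable.mul_const _).ofReal
  have i₄ : Integrable (fun x : ℂ => conj (x / μ) - 1) ν := i₂.sub (integrable_const _)
  have i₅ : Integrable (fun x : ℂ => x / μ + (conj (x / μ) - 1)) ν := i₁.add i₄
  rw [key]
  refine ⟨i₃.add i₅, ?_⟩
  rw [integral_add i₃ i₅, integral_add i₁ i₄, integral_sub i₂ (integrable_const _), m₁,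
    m₂, integral_complex_ofReal, integral_mul_const, h.variance]
  simp
  ring

variable {E : Type*} [Fintype E] [DecidableEq E]

/-- Mixed moments of products of normalized i.i.d. variables over two sets of indices. -/
theorem IsEntryDistribution.integral_prod_mul_conj_prod (h : IsEntryDistribution ν μ)
    (hμ : μ ≠ 0) (A B : Finset E) :
    Integrable (fun x : E → ℂ => (∏ e ∈ A, x e / μ) * conj (∏ e ∈ B, x e / μ))
        (Measure.pi fun _ => ν) ∧
      ∫ x : E → ℂ, (∏ e ∈ A, x e / μ) * conj (∏ e ∈ B, x e / μ) ∂(Measure.pi fun _ => ν) =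
        ((1 + (‖μ‖ ^ 2)⁻¹ : ℝ) : ℂ) ^ (A ∩ B).card := by
  have := h.prob
  -- By independence the integral factors over the cells, and only cells in both sets contribute a
  -- factor other than `1`.
  let f : E → ℂ → ℂ := fun e x =>
    (if e ∈ A then x / μ else 1) * (if e ∈ B then conj (x / μ) else 1)
  have key : (fun x : E → ℂ => (∏ e ∈ A, x e / μ) * conj (∏ e ∈ B, x e / μ)) =
      fun x => ∏ e, f e (x e) := by
    funext x
    simp only [f, Finset.prod_mul_distrib, map_prod, Finset.prod_ite_mem, Finset.univ_inter]
  have hf : ∀ e, Integrable (f e) ν ∧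
      ∫ x, f e x ∂ν = if e ∈ A ∩ B then ((1 + (‖μ‖ ^ 2)⁻¹ : ℝ) : ℂ) else 1 := by
    intro e
    by_cases hA : e ∈ A <;> by_cases hB : e ∈ B <;>
      simp only [f, hA, hB, if_true, if_false, one_mul, mul_one, Finset.mem_inter, and_true,
        and_false]
    · exact h.integral_div_mul_conj hμ
    · exact h.integral_div hμ
    · exact h.integral_conj_div hμ
    · exact ⟨integrable_const _, by simp⟩
  rw [key]
  refine ⟨Integrable.fintype_prod fun e => (hf e).1, ?_⟩
  rw [integral_fintype_prod_eq_prod, Finset.prod_congr rfl fun e _ => (hf e).2,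
    Finset.prod_ite_mem, Finset.univ_inter, Finset.prod_const]

/-- The normalized average of the products of the variables over the sets of a family. -/
noncomputable def averageProd {I : Type*} [Fintype I] (A : I → Finset E) (μ : ℂ) (x : E → ℂ) : ℂ :=
  (Fintype.card I : ℂ)⁻¹ * ∑ i, ∏ e ∈ A i, x e / μ

theorem IsEntryDistribution.integral_norm_averageProd_sub_one_sq (h : IsEntryDistribution ν μ)
    (hμ : μ ≠ 0) {I : Type*} [Fintype I] [Nonempty I] (A : I → Finset E) :
    Integrable (fun x => ‖averageProd A μ x - 1‖ ^ 2) (Measure.pi fun _ => ν) ∧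
      ∫ x, ‖averageProd A μ x - 1‖ ^ 2 ∂(Measure.pi fun _ => ν) =
        ((Fintype.card I : ℝ) ^ 2)⁻¹ *
          ∑ i, ∑ j, ((1 + (‖μ‖ ^ 2)⁻¹ : ℝ) ^ (A i ∩ A j).card - 1) := by
  have := h.prob
  set w : ℝ := 1 + (‖μ‖ ^ 2)⁻¹
  let p : I → (E → ℂ) → ℂ := fun i x => ∏ e ∈ A i, x e / μ
  have hI : (Fintype.card I : ℂ) ≠ 0 := by simp
  have hq : ∀ i j, Integrable (fun x => (p i x - 1) * conj (p j x - 1)) (Measure.pi fun _ => ν) ∧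
      ∫ x, (p i x - 1) * conj (p j x - 1) ∂(Measure.pi fun _ => ν) =
        ((w ^ (A i ∩ A j).card - 1 : ℝ) : ℂ) := by
    intro i j
    obtain ⟨i₁, m₁⟩ := h.integral_prod_mul_conj_prod hμ (A i) (A j)
    -- Taking one of the two sets empty gives the first moments, all equal to `1`.
    obtain ⟨i₂, m₂⟩ := h.integral_prod_mul_conj_prod hμ (A i) ∅
    obtain ⟨i₃, m₃⟩ := h.integral_prod_mul_conj_prod hμ ∅ (A j)
    simp only [Finset.prod_empty, map_one, mul_one, one_mul, Finset.inter_empty,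
      Finset.empty_inter, Finset.card_empty, pow_zero] at i₂ m₂ i₃ m₃
    have i₄ : Integrable (fun x => conj (p j x) - 1) (Measure.pi fun _ => ν) :=
      i₃.sub (integrable_const (1 : ℂ))
    have i₅ : Integrable (fun x => p i x + (conj (p j x) - 1)) (Measure.pi fun _ => ν) :=
      i₂.add i₄
    have e : (fun x => (p i x - 1) * conj (p j x - 1)) = fun x => p i x * conj (p j x) -
        (p i x + (conj (p j x) - 1)) := by
      funext x
      rw [map_sub, map_one]
      ring
    rw [e]
    refine ⟨i₁.sub i₅, ?_⟩
    rw [integral_sub i₁ i₅, integral_add i₂ i₄, integral_sub i₃ (integrable_const _), m₁, m₂, m₃]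
    simp [w]
  have key : ∀ x, ((‖averageProd A μ x - 1‖ ^ 2 : ℝ) : ℂ) =
      ((Fintype.card I : ℂ) ^ 2)⁻¹ * ∑ i, ∑ j, (p i x - 1) * conj (p j x - 1) := by
    intro x
    have e : averageProd A μ x - 1 = (Fintype.card I : ℂ)⁻¹ * ∑ i, (p i x - 1) := by
      rw [averageProd, Finset.sum_sub_distrib]
      simp only [Finset.sum_const, Finset.card_univ, nsmul_eq_mul, mul_one, mul_sub, p]
      rw [inv_mul_cancel₀ hI]
    rw [← Finset.sum_mul_sum, ← map_sum, ← Complex.normSq_eq_norm_sq, ← Complex.mul_conj, e,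
      map_mul, map_inv₀, Complex.conj_natCast]
    ring
  have hs : Integrable (fun x => ((‖averageProd A μ x - 1‖ ^ 2 : ℝ) : ℂ))
      (Measure.pi fun _ => ν) := by
    simp_rw [key]
    exact (integrable_finsetSum _ fun i _ => integrable_finsetSum _ fun j _ =>
      (hq i j).1).const_mul _
  refine ⟨hs.re, ?_⟩
  rw [← Complex.ofReal_inj, ← integral_complex_ofReal]
  simp_rw [key]
  rw [integral_const_mul, integral_finsetSum _ fun i _ => integrable_finsetSum _ fun j _ =>
    (hq i j).1]
  simp_rw [integral_finsetSum _ fun j _ => (hq _ j).1, (hq _ _).2]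
  push_cast
  rfl

/-- Chebyshev's inequality for the average of the products. -/
theorem IsEntryDistribution.measureReal_averageProd_le (h : IsEntryDistribution ν μ)
    (hμ : μ ≠ 0) {I : Type*} [Fintype I] [Nonempty I] (A : I → Finset E) {δ : ℝ} (hδ : 0 < δ) :
    (Measure.pi fun _ => ν).real {x | δ ≤ ‖averageProd A μ x - 1‖} ≤
      ((Fintype.card I : ℝ) ^ 2)⁻¹ *
          (∑ i, ∑ j, ((1 + (‖μ‖ ^ 2)⁻¹ : ℝ) ^ (A i ∩ A j).card - 1)) / δ ^ 2 := by
  obtain ⟨h₁, h₂⟩ := h.integral_norm_averageProd_sub_one_sq hμ A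
  rw [← h₂, le_div_iff₀ (by positivity), mul_comm]
  refine le_trans (le_of_eq ?_) (mul_meas_ge_le_integral_of_nonneg
    (ae_of_all _ fun x => by positivity) h₁ (δ ^ 2))
  congr 2
  ext x
  exact (pow_le_pow_iff_left₀ hδ.le (norm_nonneg _) two_ne_zero).symm

end SecondMoment

/-! ### Counting tuples of permutations -/

section Counting

open Finset

/-- Left multiplication by `τ⁻¹` reduces to permutations fixing `S` pointwise, that is, to
permutations of the complement of `S`. -/
theorem card_perm_eqOn {α : Type*} [Fintype α] [DecidableEq α] (τ : Equiv.Perm α) (S : Finset α) :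
    #{π : Equiv.Perm α | ∀ i ∈ S, π i = τ i} = (Fintype.card α - #S).factorial := by
  have e : {π : Equiv.Perm α // ∀ i ∈ S, π i = τ i} ≃
      {f : Equiv.Perm α // ∀ a, ¬ (a ∉ S) → f a = a} :=
    (Equiv.mulLeft τ⁻¹).subtypeEquiv fun π => by
      simp [Equiv.symm_apply_eq]
  rw [← Fintype.card_subtype, Fintype.card_congr (e.trans
    (Equiv.Perm.subtypeEquivSubtypePerm fun a => a ∉ S).symm), Fintype.card_perm,
    Fintype.card_subtype_compl, Fintype.card_coe]

/-- The tuples of permutations over which the permanent of a tensor is summed. -/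
abbrev PermTuple (d n : ℕ) : Type :=
  {σ : Fin d → Equiv.Perm (Fin n) // ∀ k : Fin d, k.val = 0 → σ k = 1}

instance (d n : ℕ) : Nonempty (PermTuple d n) := ⟨⟨1, fun _ _ => rfl⟩⟩

theorem card_permTuple_eqOn {d n : ℕ} (τ : PermTuple d n) (S : Finset (Fin n)) :
    #{σ : PermTuple d n | ∀ i ∈ S, ∀ k, σ.1 k i = τ.1 k i} = (n - #S).factorial ^ (d - 1) := by
  have h : ({σ : PermTuple d n | ∀ i ∈ S, ∀ k, σ.1 k i = τ.1 k i} : Finset _).map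
      ⟨Subtype.val, Subtype.val_injective⟩ =
      Fintype.piFinset fun k : Fin d => if k.val = 0 then {1} else
        ({π : Equiv.Perm (Fin n) | ∀ i ∈ S, π i = τ.1 k i} : Finset _) := by
    ext σ
    simp only [Finset.mem_map, mem_filter, mem_univ, true_and, Function.Embedding.coeFn_mk,
      Fintype.mem_piFinset]
    constructor
    · rintro ⟨σ, hσ, rfl⟩ k
      split_ifs with hk
      · simp [σ.2 k hk]
      · simpa using fun i hi => hσ i hi k
    · intro hσ
      have h₀ : ∀ k : Fin d, k.val = 0 → σ k = 1 := fun k hk => by simpa [hk] using hσ k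
      refine ⟨⟨σ, h₀⟩, fun i hi k => ?_, rfl⟩
      by_cases hk : k.val = 0
      · simp only
        rw [h₀ k hk, τ.2 k hk]
      · have := hσ k
        simp only [hk, if_false, mem_filter, mem_univ, true_and] at this
        exact this i hi
  rw [← card_map, h, Fintype.card_piFinset]
  have h' : ∀ k : Fin d, #(if k.val = 0 then {1} else
      ({π : Equiv.Perm (Fin n) | ∀ i ∈ S, π i = τ.1 k i} : Finset _)) =
      if k.val = 0 then 1 else (n - #S).factorial := by
    intro k
    split_ifs
    · simp
    · have h := card_perm_eqOn (τ.1 k) S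
      rw [Fintype.card_fin] at h
      convert h
  rw [prod_congr rfl fun k _ => h' k]
  cases d with
  | zero => simp
  | succ m => simp [Fin.prod_univ_succ]

theorem card_permTuple (d n : ℕ) : Fintype.card (PermTuple d n) = n.factorial ^ (d - 1) := by
  simpa using card_permTuple_eqOn (⟨1, fun _ _ => rfl⟩ : PermTuple d n) ∅

/-- One of the `d - 1` factors `(n - m)!` combines with the binomial coefficient and `m!` into `n!`.
A second one absorbs `n`, because `m ≥ 1`. Having this second factor is exactly `d ≥ 3`, and it is
the source of the decay `1 / n`. -/
theorem choose_mul_factorial_pow_le {d n m : ℕ} (hd : 3 ≤ d) (hm : m ≠ 0) (hmn : m ≤ n) :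
    n.choose m * (n - m).factorial ^ (d - 1) * (m.factorial * n) ≤ n.factorial ^ (d - 1) := by
  obtain ⟨k, rfl⟩ := Nat.exists_eq_add_of_le hd
  have h₁ : n * (n - m).factorial ≤ n.factorial := by
    obtain ⟨j, rfl⟩ : ∃ j, n = j + 1 := ⟨n - 1, by omega⟩
    rw [Nat.factorial_succ]
    exact Nat.mul_le_mul_left _ (Nat.factorial_le (by omega))
  have h₂ : (n - m).factorial ^ k ≤ n.factorial ^ k :=
    Nat.pow_le_pow_left (Nat.factorial_le (by omega)) k
  calc n.choose m * (n - m).factorial ^ (3 + k - 1) * (m.factorial * n)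
      = (n.choose m * m.factorial * (n - m).factorial) * (n * (n - m).factorial) *
          (n - m).factorial ^ k := by
        rw [show 3 + k - 1 = k + 2 by omega]; ring
    _ ≤ n.factorial * n.factorial * n.factorial ^ k := by
        rw [Nat.choose_mul_factorial_mul_factorial hmn]
        gcongr
    _ = n.factorial ^ (3 + k - 1) := by
        rw [show 3 + k - 1 = k + 2 by omega]; ring

theorem sum_powerset_pow_card_sub {α : Type*} (v : ℝ) (T : Finset α) :
    ∑ S ∈ T.powerset, (if #S = 0 then 0 else v ^ #S) = (1 + v) ^ #T - 1 := by
  have h := sum_powerset_apply_card (fun m => if m = 0 then 0 else v ^ m) (x := T)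
  rw [h, add_comm 1 v, add_pow, sum_range_succ', sum_range_succ' _ (#T)]
  simp [mul_comm]

/-- Expand `(1 + v) ^ m - 1` over the nonempty subsets `S` of the agreement set and exchange the
sums. The tuples agreeing with `τ` on a given `S` are counted exactly, and after grouping by size
`choose_mul_factorial_pow_le` leaves the exponential series divided by `n`. -/
theorem sum_one_add_pow_card_agree_le {d n : ℕ} (hd : 3 ≤ d) (hn : n ≠ 0) {v : ℝ} (hv : 0 ≤ v)
    (τ : PermTuple d n) :
    ∑ σ : PermTuple d n, ((1 + v) ^ #{i | ∀ k, σ.1 k i = τ.1 k i} - 1) ≤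
      Fintype.card (PermTuple d n) * (Real.exp v / n) := by
  have hn' : (0 : ℝ) < n := by positivity
  calc ∑ σ : PermTuple d n, ((1 + v) ^ #{i | ∀ k, σ.1 k i = τ.1 k i} - 1)
      = ∑ σ : PermTuple d n, ∑ S : Finset (Fin n),
          if (∀ i ∈ S, ∀ k, σ.1 k i = τ.1 k i) then (if #S = 0 then 0 else v ^ #S) else 0 := by
        refine sum_congr rfl fun σ _ => ?_
        rw [← sum_powerset_pow_card_sub, ← sum_filter]
        refine sum_congr ?_ fun _ _ => rfl
        ext S
        simp [subset_iff]
    _ = ∑ S : Finset (Fin n), ((n - #S).factorial ^ (d - 1) : ℕ) *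
          (if #S = 0 then 0 else v ^ #S) := by
        rw [sum_comm]
        refine sum_congr rfl fun S _ => ?_
        rw [← sum_filter, sum_const, card_permTuple_eqOn, nsmul_eq_mul]
    _ = ∑ m ∈ range (n + 1), n.choose m * (((n - m).factorial ^ (d - 1) : ℕ) *
          (if m = 0 then 0 else v ^ m)) := by
        have := sum_powerset_apply_card (fun m => (((n - m).factorial ^ (d - 1) : ℕ) : ℝ) *
          (if m = 0 then 0 else v ^ m)) (x := (univ : Finset (Fin n)))
        simpa only [powerset_univ, card_univ, Fintype.card_fin, nsmul_eq_mul] using this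
    _ ≤ ∑ m ∈ range (n + 1), ((n.factorial ^ (d - 1) : ℕ) / (n : ℝ)) *
          (v ^ m / m.factorial) := by
        refine sum_le_sum fun m hm => ?_
        by_cases h0 : m = 0
        · simp only [h0, if_true, mul_zero]
          positivity
        · have h₁ : ((n.choose m * (n - m).factorial ^ (d - 1) * (m.factorial * n) : ℕ) : ℝ) ≤
              (n.factorial ^ (d - 1) : ℕ) :=
            Nat.cast_le.2 (choose_mul_factorial_pow_le hd h0 (by simpa [Nat.lt_succ_iff] using hm))
          have hm' : (0 : ℝ) < m.factorial := by positivity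
          rw [if_neg h0, div_mul_div_comm, le_div_iff₀ (by positivity)]
          have := mul_le_mul_of_nonneg_right h₁ (pow_nonneg hv m)
          push_cast at this ⊢
          linarith
    _ ≤ _ := by
        rw [← mul_sum, card_permTuple]
        have := mul_le_mul_of_nonneg_left (Real.sum_le_exp_of_nonneg hv (n + 1))
          (show (0 : ℝ) ≤ (n.factorial ^ (d - 1) : ℕ) / (n : ℝ) by positivity)
        refine this.trans (le_of_eq ?_)
        ring

/-- The cells `(i, σ_2(i), …, σ_d(i))` of a tuple of permutations. -/
def PermTuple.cells {d n : ℕ} (σ : PermTuple d n) : Finset (Fin d → Fin n) :=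
  univ.image fun i k => σ.1 k i

variable {d n : ℕ}

theorem PermTuple.cell_inj [NeZero d] {σ τ : PermTuple d n} {i j : Fin n}
    (h : (fun k => σ.1 k i) = fun k => τ.1 k j) : i = j := by
  simpa [σ.2 0 rfl, τ.2 0 rfl] using congrFun h 0

theorem PermTuple.prod_cells [NeZero d] (σ : PermTuple d n) (f : (Fin d → Fin n) → ℂ) :
    ∏ e ∈ σ.cells, f e = ∏ i, f fun k => σ.1 k i :=
  prod_image fun _ _ _ _ h => PermTuple.cell_inj h

/-- The first permutation is the identity, so a cell determines its index `i`; two tuples can share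
a cell only at the same `i`. -/
theorem PermTuple.card_cells_inter [NeZero d] (σ τ : PermTuple d n) :
    #(σ.cells ∩ τ.cells) = #{i | ∀ k, σ.1 k i = τ.1 k i} := by
  have : σ.cells ∩ τ.cells =
      ({i | ∀ k, σ.1 k i = τ.1 k i} : Finset (Fin n)).image fun i k => σ.1 k i := by
    ext e
    simp only [PermTuple.cells, mem_inter, mem_image, mem_univ, true_and, mem_filter]
    constructor
    · rintro ⟨⟨i, rfl⟩, j, hj⟩
      obtain rfl := PermTuple.cell_inj hj
      exact ⟨j, fun k => (congrFun hj k).symm, rfl⟩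
    · rintro ⟨i, hi, rfl⟩
      exact ⟨⟨i, rfl⟩, i, funext fun k => (hi k).symm⟩
  rw [this, card_image_of_injective _ fun _ _ h => PermTuple.cell_inj h]

end Counting

/-! ### Concentration of the permanent and of the mean entry -/

section Concentration

variable {d n : ℕ} {ν : Measure ℂ} {μ : ℂ}

theorem averageProd_cells [NeZero d] (μ : ℂ) (R : Tensor d n) :
    averageProd (PermTuple.cells (d := d) (n := n)) μ R =
      tensorPer R / ((n.factorial : ℂ) ^ (d - 1) * μ ^ n) := by
  rw [averageProd, card_permTuple, tensorPer, Finset.mul_sum, Finset.sum_div]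
  refine Finset.sum_congr rfl fun σ _ => ?_
  rw [PermTuple.prod_cells, Finset.prod_div_distrib]
  simp
  ring

theorem averageProd_singleton (μ : ℂ) (R : Tensor d n) :
    averageProd (fun e : Fin d → Fin n => {e}) μ R = (∑ e, R e) / ((n ^ d : ℕ) : ℂ) / μ := by
  simp only [averageProd, Finset.prod_singleton, ← Finset.sum_div]
  simp
  ring

theorem measureReal_tensorPer_le (h : IsEntryDistribution ν μ) (hμ : μ ≠ 0) [NeZero d]
    (hd : 3 ≤ d) (hn : n ≠ 0) {δ : ℝ} (hδ : 0 < δ) :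
    (tensorDistribution d n ν).real
        {R | δ ≤ ‖averageProd (PermTuple.cells (d := d) (n := n)) μ R - 1‖} ≤
      Real.exp (‖μ‖ ^ 2)⁻¹ / n / δ ^ 2 := by
  refine (h.measureReal_averageProd_le hμ _ hδ).trans ?_
  have hc : (0 : ℝ) < Fintype.card (PermTuple d n) := by exact_mod_cast Fintype.card_pos
  gcongr
  rw [inv_mul_le_iff₀ (by positivity), Finset.sum_comm]
  calc _ ≤ ∑ _τ : PermTuple d n, (Fintype.card (PermTuple d n) : ℝ) *
          (Real.exp (‖μ‖ ^ 2)⁻¹ / n) := by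
        refine Finset.sum_le_sum fun τ _ => ?_
        simp_rw [PermTuple.card_cells_inter]
        exact sum_one_add_pow_card_agree_le hd hn (by positivity) τ
    _ = _ := by
        rw [Finset.sum_const, Finset.card_univ, nsmul_eq_mul]
        ring

/-- For singletons only the diagonal pairs contribute to the second moment: `n ^ d` terms out of `n
^ (2d)`. -/
theorem measureReal_mean_le (h : IsEntryDistribution ν μ) (hμ : μ ≠ 0)
    (hn : n ≠ 0) {δ : ℝ} (hδ : 0 < δ) :
    (tensorDistribution d n ν).real
        {R | δ ≤ ‖averageProd (fun e : Fin d → Fin n => {e}) μ R - 1‖} ≤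
      (‖μ‖ ^ 2)⁻¹ / n ^ d / δ ^ 2 := by
  have : Nonempty (Fin n) := ⟨⟨0, Nat.pos_of_ne_zero hn⟩⟩
  refine (h.measureReal_averageProd_le hμ _ hδ).trans (le_of_eq ?_)
  have hs : ∀ i j : Fin d → Fin n, (1 + (‖μ‖ ^ 2)⁻¹ : ℝ) ^
      (({i} : Finset (Fin d → Fin n)) ∩ {j}).card - 1 = if i = j then (‖μ‖ ^ 2)⁻¹ else 0 := by
    intro i j
    split_ifs with hij
    · simp [hij]
    · simp [Finset.singleton_inter_of_notMem, hij]
  simp_rw [hs]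
  have : (n : ℝ) ≠ 0 := by exact_mod_cast hn
  simp
  field_simp

/-- Here `|U ^ n - 1| ≤ exp (n |U - 1|) - 1 ≤ exp (ε / 8) - 1 ≤ ε / 4`. Hence `|X - U ^ n| ≤ ε / 2`,
while `|X| ≥ 3 / 4`. -/
theorem norm_one_sub_pow_div_le {X U : ℂ} {ε : ℝ} (hε : ε ≤ 1) (hn : n ≠ 0)
    (hX : ‖X - 1‖ < ε / 4) (hU : ‖U - 1‖ < ε / (8 * n)) : ‖1 - U ^ n / X‖ ≤ ε := by
  have hn' : (0 : ℝ) < n := by positivity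
  have hε₀ : 0 < ε := by linarith [norm_nonneg (X - 1)]
  have hp : ‖U ^ n - 1‖ ≤ ε / 4 := by
    have h₁ := Finset.norm_prod_one_add_sub_one_le (Finset.range n) fun _ => U - 1
    simp only [add_sub_cancel, Finset.prod_const, Finset.card_range, Finset.sum_const,
      nsmul_eq_mul] at h₁
    have h₂ : n * ‖U - 1‖ ≤ ε / 8 := by
      rw [lt_div_iff₀ (by positivity)] at hU
      linarith
    have h₃ : |ε / 8| = ε / 8 := abs_of_pos (by positivity)
    have h₄ := Real.abs_exp_sub_one_le (x := ε / 8) (by rw [h₃]; linarith)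
    rw [h₃] at h₄
    have h₅ := Real.exp_le_exp.2 h₂
    linarith [le_abs_self (Real.exp (ε / 8) - 1)]
  have hX' : 3 / 4 ≤ ‖X‖ := by
    have := norm_sub_norm_le (1 : ℂ) X
    rw [norm_one, norm_sub_rev] at this
    linarith
  have hX₀ : X ≠ 0 := by
    rintro rfl
    simp at hX'
    linarith
  rw [one_sub_div hX₀, norm_div, div_le_iff₀ (by linarith)]
  have := norm_sub_le (X - 1) (U ^ n - 1)
  rw [sub_sub_sub_cancel_right] at this
  nlinarith

theorem measureReal_meanPermanent_ge (h : IsEntryDistribution ν μ) (hμ : μ ≠ 0)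
    (hd : 3 ≤ d) (hn : n ≠ 0) {ε : ℝ} (hε₀ : 0 < ε) (hε : ε ≤ 1) :
    1 - 80 * Real.exp (‖μ‖ ^ 2)⁻¹ / (n * ε ^ 2) ≤
      (tensorDistribution d n ν).real {R | ‖1 - meanPermanent d n R / tensorPer R‖ ≤ ε} := by
  have := h.prob
  have : NeZero d := ⟨by omega⟩
  have : IsProbabilityMeasure (tensorDistribution d n ν) := by
    unfold tensorDistribution; infer_instance
  have hn' : (1 : ℝ) ≤ n := by exact_mod_cast Nat.one_le_iff_ne_zero.2 hn
  have hn₀ : (0 : ℝ) < n := by linarith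
  have h₁ := measureReal_tensorPer_le h hμ hd hn (δ := ε / 4) (by positivity)
  have h₂ := measureReal_mean_le (d := d) h hμ hn (δ := ε / (8 * n)) (by positivity)
  set B₁ := {R : Tensor d n | ε / 4 ≤ ‖averageProd (PermTuple.cells (d := d) (n := n)) μ R - 1‖}
  set B₂ := {R : Tensor d n | ε / (8 * n) ≤
    ‖averageProd (fun e : Fin d → Fin n => {e}) μ R - 1‖}
  -- If `tensorPer R = 0`, the quotient is `0` and the norm is `1`, so for `ε < 1` such an `R` is
  -- not in `G`.
  set G := {R : Tensor d n | ‖1 - meanPermanent d n R / tensorPer R‖ ≤ ε}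
  have hcov : (Set.univ : Set (Tensor d n)) ⊆ G ∪ (B₁ ∪ B₂) := by
    intro R _
    by_cases hB₁ : R ∈ B₁
    · exact Or.inr (Or.inl hB₁)
    by_cases hB₂ : R ∈ B₂
    · exact Or.inr (Or.inr hB₂)
    refine Or.inl ?_
    have := norm_one_sub_pow_div_le hε hn (not_le.1 hB₁) (not_le.1 hB₂)
    rw [averageProd_cells, averageProd_singleton] at this
    have e : meanPermanent d n R / tensorPer R =
        ((∑ e, R e) / ((n ^ d : ℕ) : ℂ) / μ) ^ n /
          (tensorPer R / ((n.factorial : ℂ) ^ (d - 1) * μ ^ n)) := by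
      rw [meanPermanent, div_pow _ μ, div_div_eq_mul_div]
      have := pow_ne_zero n hμ
      field_simp
    rwa [← e] at this
  have h₃ : 1 ≤ (tensorDistribution d n ν).real G + ((tensorDistribution d n ν).real B₁ +
      (tensorDistribution d n ν).real B₂) := by
    have := (measureReal_mono (μ := tensorDistribution d n ν) hcov).trans ((measureReal_union_le _ _).trans
      (add_le_add_right (measureReal_union_le _ _) _))
    simpa using this
  have h₄ : (‖μ‖ ^ 2)⁻¹ ≤ Real.exp (‖μ‖ ^ 2)⁻¹ := by linarith [Real.add_one_le_exp (‖μ‖ ^ 2)⁻¹]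
  -- The threshold `ε / (8 n)` costs a factor `64 n²`, which `n ^ d ≥ n ^ 3` outweighs by one power
  -- of `n`. With the `16` from the threshold `ε / 4`, this gives `80`.
  have h₅ : (‖μ‖ ^ 2)⁻¹ / n ^ d / (ε / (8 * n)) ^ 2 ≤
      64 * Real.exp (‖μ‖ ^ 2)⁻¹ / (n * ε ^ 2) := by
    calc _ ≤ Real.exp (‖μ‖ ^ 2)⁻¹ / n ^ 3 / (ε / (8 * n)) ^ 2 := by gcongr
      _ = _ := by field_simp; norm_num
  have h₆ : Real.exp (‖μ‖ ^ 2)⁻¹ / n / (ε / 4) ^ 2 =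
      16 * Real.exp (‖μ‖ ^ 2)⁻¹ / (n * ε ^ 2) := by field_simp; norm_num
  have h₇ : 80 * Real.exp (‖μ‖ ^ 2)⁻¹ / (n * ε ^ 2) = 16 * Real.exp (‖μ‖ ^ 2)⁻¹ / (n * ε ^ 2) +
      64 * Real.exp (‖μ‖ ^ 2)⁻¹ / (n * ε ^ 2) := by ring
  linarith

end Concentration

/-! ### Asymptotics in `n`. -/

theorem mainTheorem2 (c ρ : ℝ) (hc₀ : 0 < c) (hc₁ : c < 1 / 8) (hρ₀ : 0 < ρ)
    (hρ₁ : ρ < 1 / 8 - c) :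
    ∃ P : ∀ d n : ℕ, Tensor d n → ℂ, IsPolyTimeComputable P ∧
      ∀ (d : ℕ → ℕ) (μ : ℕ → ℂ) (ν : ℕ → Measure ℂ) (M : ℝ),
        (∀ᶠ n : ℕ in atTop, 3 ≤ d n) →
        (∃ k : ℕ, (fun n : ℕ => (d n : ℝ)) =O[atTop] fun n : ℕ => Real.log n ^ k) →
        (∀ n : ℕ, IsEntryDistribution (ν n) (μ n)) →
        (∀ n : ℕ, ∫ x, ‖x - μ n‖ ^ 3 ∂(ν n) ≤ M) →
        (∀ᶠ n : ℕ in atTop, (Real.log n / ((d n : ℝ) - 1) ^ 6) ^ (-c) ≤ ‖μ n‖) →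
        Tendsto
          (fun n : ℕ => tensorDistribution (d n) n (ν n)
            {R | ‖1 - P (d n) n R / tensorPer R‖ ≤ (n : ℝ) ^ (-ρ)})
          atTop (𝓝 1) := by
  refine ⟨meanPermanent, isPolyTimeComputable_meanPermanent, ?_⟩
  intro d μ ν M hd _ hν _ hμ
  have hprob : ∀ n, IsProbabilityMeasure (tensorDistribution (d n) n (ν n)) := fun n => by
    have := (hν n).prob
    unfold tensorDistribution
    infer_instance
  have hlog : Tendsto (fun n : ℕ => Real.log n) atTop atTop :=
    Real.tendsto_log_atTop.comp tendsto_natCast_atTop_atTop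
  -- The exponent `1 / 4` on the left bounds `2 * c`; the factor `1 / 4` on the right will give `exp
  -- v ≤ n ^ (1 / 4)`. The threshold `16` is where `√l ≤ l / 4` begins.
  have hquarter : ∀ᶠ n : ℕ in atTop, Real.log n ^ (1 / 4 : ℝ) ≤ 1 / 4 * Real.log n := by
    filter_upwards [hlog.eventually_ge_atTop 16] with n hl
    refine (Real.rpow_le_rpow_of_exponent_le (by linarith)
      (show (1 / 4 : ℝ) ≤ 1 / 2 by norm_num)).trans ?_
    rw [← Real.sqrt_eq_rpow, Real.sqrt_le_iff]
    constructor <;> nlinarith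
  have hbound : ∀ᶠ n : ℕ in atTop, 1 - 80 * (n : ℝ) ^ (-(1 / 2) : ℝ) ≤
      (tensorDistribution (d n) n (ν n)).real
        {R | ‖1 - meanPermanent (d n) n R / tensorPer R‖ ≤ (n : ℝ) ^ (-ρ)} := by
    filter_upwards [hd, hμ, hquarter, hlog.eventually_ge_atTop 1, eventually_ge_atTop 1] with
      n hd hμ hq hl hn
    have hn₁ : (1 : ℝ) ≤ n := by exact_mod_cast hn
    have hn₀ : (0 : ℝ) < n := by linarith
    have hd' : (1 : ℝ) ≤ ((d n : ℝ) - 1) ^ 6 := by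
      have : (3 : ℝ) ≤ d n := by exact_mod_cast hd
      exact one_le_pow₀ (by linarith)
    have hx₀ : 0 < Real.log n / ((d n : ℝ) - 1) ^ 6 := by positivity
    -- Since the exponent `-c` is negative, dividing by `(d - 1) ^ 6 ≥ 1` only strengthens the lower
    -- bound on `‖μ n‖`.
    have hx₁ : Real.log n / ((d n : ℝ) - 1) ^ 6 ≤ Real.log n :=
      div_le_self (by linarith) hd'
    have hμ₀ : 0 < ‖μ n‖ := (Real.rpow_pos_of_pos hx₀ _).trans_le hμ
    have hv : (‖μ n‖ ^ 2)⁻¹ ≤ 1 / 4 * Real.log n := by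
      refine le_trans ?_ hq
      calc (‖μ n‖ ^ 2)⁻¹ ≤ (((Real.log n / ((d n : ℝ) - 1) ^ 6) ^ (-c)) ^ 2)⁻¹ := by
            gcongr
        _ = (Real.log n / ((d n : ℝ) - 1) ^ 6) ^ (2 * c) := by
            rw [← Real.rpow_natCast, ← Real.rpow_mul hx₀.le, ← Real.rpow_neg hx₀.le]
            congr 1
            push_cast
            ring
        _ ≤ Real.log n ^ (2 * c) := Real.rpow_le_rpow hx₀.le hx₁ (by linarith)
        _ ≤ Real.log n ^ (1 / 4 : ℝ) := Real.rpow_le_rpow_of_exponent_le hl (by linarith)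
    have he : Real.exp (‖μ n‖ ^ 2)⁻¹ ≤ (n : ℝ) ^ (1 / 4 : ℝ) := by
      rw [Real.rpow_def_of_pos hn₀]
      exact Real.exp_le_exp.2 (by linarith)
    refine le_trans ?_ (measureReal_meanPermanent_ge (hν n) (norm_pos_iff.1 hμ₀) hd (by omega)
      (Real.rpow_pos_of_pos hn₀ _) (Real.rpow_le_one_of_one_le_of_nonpos hn₁ (by linarith)))
    have : 80 * Real.exp (‖μ n‖ ^ 2)⁻¹ / (n * ((n : ℝ) ^ (-ρ)) ^ 2) ≤
        80 * (n : ℝ) ^ (-(1 / 2) : ℝ) := by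
      rw [div_le_iff₀ (by positivity), mul_assoc]
      refine mul_le_mul_of_nonneg_left (he.trans ?_) (by norm_num)
      -- The comparison of exponents is exactly `ρ ≤ 1 / 8`.
      calc (n : ℝ) ^ (1 / 4 : ℝ) ≤ (n : ℝ) ^ (-(1 / 2) + (1 + -ρ * 2) : ℝ) :=
            Real.rpow_le_rpow_of_exponent_le hn₁ (by linarith)
        _ = _ := by
            rw [Real.rpow_add hn₀, Real.rpow_add hn₀, Real.rpow_one, Real.rpow_mul hn₀.le]
            norm_cast
    linarith
  have hlim : Tendsto (fun n : ℕ => ENNReal.ofReal (1 - 80 * (n : ℝ) ^ (-(1 / 2) : ℝ))) atTop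
      (𝓝 1) := by
    have := (tendsto_rpow_neg_atTop (show (0 : ℝ) < 1 / 2 by norm_num)).comp
      tendsto_natCast_atTop_atTop
    simpa using ENNReal.tendsto_ofReal ((this.const_mul 80).const_sub 1)
  refine tendsto_of_tendsto_of_tendsto_of_le_of_le' hlim tendsto_const_nhds ?_
    (Eventually.of_forall fun n => prob_le_one)
  filter_upwards [hbound] with n hn
  exact ENNReal.ofReal_le_of_le_toReal hn
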